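/- Let $\mathbb{D}=\{z\in\mathbb{C}:|z|<1\}$ and fix $0<\beta<1$, $0\le\lambda<1$ and $z_0\in\mathbb{D}\setminus\{0\}$. Let $\mathcal{F}(\lambda)$ be the class of analytic functions $f$ on $\mathbb{D}$ with $f(0)=0$, $f'(0)=1$, $f''(0)=2\lambda(1-\beta)$, $f'(z)\neq 0$ and $$\operatorname{Re}\left(1+\frac{zf''(z)}{f'(z)}\right)>\beta\qquad(z\in\mathbb{D}).$$ For such $f$ let $\log f'$ denote the analytic branch on $\mathbb{D}$ of the logarithm of $f'$ with $\log f'(0)=0$, and put $V(z_0,\lambda,\beta)=\{\log f'(z_0): f\in\mathcal{F}(\lambda)\}$. With $\delta(z,\lambda)=\dfrac{z+\lambda}{1+\lambda z}$, define for $|a|= 1$ $$F_{a,\lambda}(z)=\int_0^z\exp\left(\int_0^{\xi}\frac{2(1-\beta)\,\delta(a\zeta,\lambda)}{1-\zeta\,\delta(a\zeta,\lambda)}\,d\zeta\right)d\xi\qquad(z\in\mathbb{D}).$$ Then $F_{e^{i\theta},\lambda}\in\mathcal{F}(\lambda)$ for every $\theta\in(-\pi,\pi]$, and the boundary $\partial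 V(z_0,\lambda,\beta)$ is the Jordan curve given by $$(-\pi,\pi]\ni\theta\mapsto\log F'_{e^{i\theta},\lambda}(z_0)=\int_0^{z_0}\frac{2(1-\beta)\,\delta(e^{i\theta}z,\lambda)}{1-z\,\delta(e^{i\theta}z,\lambda)}\,dz.$$ Moreover, if $\log f'(z_0)=\log F'_{e^{i\theta},\lambda}(z_0)$ for some $f\in\mathcal{F}(\lambda)$ and $\theta\in(-\pi,\pi]$, then $f=F_{e^{i\theta},\lambda}$ on $\mathbb{D}$. -/

import Mathlib

namespace RegionOfVariability

open Metric Set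

/-- The open unit disk `𝔻`. -/
def unitDisk : Set ℂ := ball 0 1

/-- The class `𝓕` (with parameter `β`) of normalized analytic functions on `𝔻` with
`Re (1 + z f''(z) / f'(z)) > β` on `𝔻`. The quotient is meant to be defined on all of `𝔻`,
so that `f'` has no zeros there. Only the values of `f` on `𝔻` matter. -/
structure IsClassF (β : ℝ) (f : ℂ → ℂ) : Prop where
  analytic : DifferentiableOn ℂ f unitDisk
  map_zero : f 0 = 0
  deriv_zero : deriv f 0 = 1
  deriv_ne_zero : ∀ z ∈ unitDisk, deriv f z ≠ 0
  re_gt : ∀ z ∈ unitDisk, β < (1 + z * deriv (deriv f) z / deriv f z).re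

/-- The subclass `𝓕(λ)`: those `f ∈ 𝓕` with `f''(0) = 2 λ (1 - β)`. -/
def classF (β lam : ℝ) : Set (ℂ → ℂ) :=
  {f | IsClassF β f ∧ deriv (deriv f) 0 = 2 * (lam : ℂ) * (1 - (β : ℂ))}

/-- `L` is the analytic branch of `log g` on `𝔻` with `L 0 = 0`. -/
structure IsLogBranch (g L : ℂ → ℂ) : Prop where
  analytic : DifferentiableOn ℂ L unitDisk
  map_zero : L 0 = 0
  exp_eq : ∀ z ∈ unitDisk, Complex.exp (L z) = g z

theorem IsLogBranch.eqOn {g L M : ℂ → ℂ} (hL : IsLogBranch g L) (hM : IsLogBranch g M) :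
    EqOn L M unitDisk := by
  have key : ∀ {N : ℂ → ℂ}, IsLogBranch g N → ∀ z ∈ unitDisk, deriv N z = deriv g z / g z := by
    intro N hN z hz
    have hnhds : unitDisk ∈ nhds z := isOpen_ball.mem_nhds hz
    have hd : HasDerivAt N (deriv N z) z := (hN.analytic.differentiableAt hnhds).hasDerivAt
    have h1 : HasDerivAt g (Complex.exp (N z) * deriv N z) z :=
      hd.cexp.congr_of_eventuallyEq
        (Filter.eventually_of_mem hnhds fun w hw => (hN.exp_eq w hw).symm)
    rw [h1.deriv, hN.exp_eq z hz, mul_div_cancel_left₀]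
    rw [← hN.exp_eq z hz]
    exact Complex.exp_ne_zero _
  refine isOpen_ball.eqOn_of_deriv_eq (convex_ball (0 : ℂ) 1).isPreconnected
    hL.analytic hM.analytic ?_ (mem_ball_self one_pos) (by rw [hL.map_zero, hM.map_zero])
  intro z hz
  rw [key hL z hz, key hM z hz]

theorem exists_isLogBranch {g : ℂ → ℂ} (hg : DifferentiableOn ℂ g unitDisk) (h0 : g 0 = 1)
    (hne : ∀ z ∈ unitDisk, g z ≠ 0) : ∃ L, IsLogBranch g L := by
  have hg' : DifferentiableOn ℂ (deriv g) unitDisk := hg.deriv isOpen_ball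
  obtain ⟨M, hM⟩ := (hg'.div hg hne).isExactOn_ball
  have hd : ∀ z ∈ unitDisk, HasDerivAt (fun z => Complex.exp (M z - M 0) / g z) 0 z := by
    intro z hz
    have hgz := (hg.differentiableAt (isOpen_ball.mem_nhds hz)).hasDerivAt
    have hMz : HasDerivAt M (deriv g z / g z) z := hM z hz
    have hz0 : g z ≠ 0 := hne z hz
    have h := (hMz.sub_const (M 0)).cexp.div hgz hz0
    have he : (Complex.exp (M z - M 0) * (deriv g z / g z) * g z
        - Complex.exp (M z - M 0) * deriv g z) / g z ^ 2 = 0 := by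
      rw [mul_assoc, div_mul_cancel₀ _ hz0, sub_self, zero_div]
    rw [he] at h
    exact h
  have h0mem : (0 : ℂ) ∈ unitDisk := mem_ball_self one_pos
  refine ⟨fun z => M z - M 0, ?_, by simp, ?_⟩
  · intro z hz
    exact ((hM z hz).sub_const (M 0)).differentiableAt.differentiableWithinAt
  · intro z hz
    have hc : (fun z => Complex.exp (M z - M 0) / g z) z = (fun _ => (1 : ℂ)) z := by
      refine isOpen_ball.eqOn_of_deriv_eq (convex_ball (0 : ℂ) 1).isPreconnected
        (fun w hw => (hd w hw).differentiableAt.differentiableWithinAt)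
        (differentiableOn_const _) ?_ h0mem (by simp [h0]) hz
      intro w hw
      rw [(hd w hw).deriv]
      simp
    exact (div_eq_one_iff_eq (hne z hz)).1 hc

open Classical in
/-- The analytic branch of `log g` on `𝔻` which vanishes at `0` (`0` if there is none). -/
noncomputable def logBranch (g : ℂ → ℂ) (z : ℂ) : ℂ :=
  if h : ∃ L, IsLogBranch g L then h.choose z else 0

theorem isLogBranch_logBranch {g : ℂ → ℂ} (h : ∃ L, IsLogBranch g L) :
    IsLogBranch g (logBranch g) := by
  have : logBranch g = h.choose := by
    funext z
    simp [logBranch, h]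
  rw [this]
  exact h.choose_spec

/-- `log f'` for `f ∈ 𝓕`: this really is the branch of the logarithm of `f'`. -/
theorem IsClassF.isLogBranch {β : ℝ} {f : ℂ → ℂ} (hf : IsClassF β f) :
    IsLogBranch (deriv f) (logBranch (deriv f)) :=
  isLogBranch_logBranch
    (exists_isLogBranch (hf.analytic.deriv isOpen_ball) hf.deriv_zero hf.deriv_ne_zero)

/-- The region of variability `V(z₀, λ, β) = {log f'(z₀) : f ∈ 𝓕(λ)}`. -/
noncomputable def region (z₀ : ℂ) (lam β : ℝ) : Set ℂ :=
  {w | ∃ f ∈ classF β lam, w = logBranch (deriv f) z₀}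

/-- `∫₀^z φ(ζ) dζ`, along the segment from `0` to `z`. -/
noncomputable def segmentIntegral (φ : ℂ → ℂ) (z : ℂ) : ℂ :=
  ∫ t in (0 : ℝ)..1, φ ((t : ℂ) * z) * z

/-- `δ(z, λ) = (z + λ) / (1 + λ z)`, for real `λ`. -/
noncomputable def delta (z : ℂ) (lam : ℝ) : ℂ := (z + lam) / (1 + lam * z)

/-- The integrand `2 (1 - β) δ(aζ, λ) / (1 - ζ δ(aζ, λ))`. -/
noncomputable def extremalIntegrand (a : ℂ) (lam β : ℝ) (ζ : ℂ) : ℂ :=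
  2 * (1 - (β : ℂ)) * delta (a * ζ) lam / (1 - ζ * delta (a * ζ) lam)

/-- The extremal function `F_{a,λ}`. -/
noncomputable def extremal (a : ℂ) (lam β : ℝ) (z : ℂ) : ℂ :=
  segmentIntegral (fun ξ => Complex.exp (segmentIntegral (extremalIntegrand a lam β) ξ)) z

/-- `θ ↦ γ θ`, `θ ∈ (-π, π]`, is a Jordan curve: a closed continuous curve without
self-intersections. -/
structure IsJordanParam (γ : ℝ → ℂ) : Prop where
  continuousOn : ContinuousOn γ (Icc (-Real.pi) Real.pi)
  closed : γ (-Real.pi) = γ Real.pi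
  injOn : InjOn γ (Ioc (-Real.pi) Real.pi)

end RegionOfVariability

open RegionOfVariability

open Metric Set Filter Topology

namespace RegionOfVariability

/-! Passing to `L = log f'` linearizes the problem: the class becomes `L(0) = 0`, `L'(0) = 2λ(1-β)`,
`Re (z L') > β - 1`. Hence `V` is convex, and quadratic perturbations of one member give it interior
points (`interior_region_nonempty`).

Two uses of Schwarz's lemma show that at each `z ≠ 0` the value `L'(z)` is the extremal integrand
with `e^{iθ}` replaced by some `g`, `|g| ≤ 1` (`IsLogClass.exists_deriv_eq`). Let `M = log F_a'`
with `|a| = 1`, and let `H` be the primitive of `a z / P²`, vanishing at `0`, where `P` is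
`extremalDenom a lam`. Then `Re ((L' - M') / H') ≤ 0`, and `Re (1 + z H'' / H') > 0`. For such a
convex `H` the inequality integrates to `Re ((L - M) / H) ≤ 0` (`comparison`). So `H(z₀)` is normal
to a supporting line of `V` at `M(z₀)`, and the maximum principle allows equality `L(z₀) = M(z₀)`
only for `L = M` (`exists_support`).

This rigidity gives both the uniqueness of the extremal functions and the injectivity of the curve.
A Jordan curve inside the frontier of a planar convex set with interior fills that frontier
(`Convex.frontier_eq_image_of_jordan`). -/

theorem isOpen_unitDisk : IsOpen unitDisk := isOpen_ball

theorem zero_mem_unitDisk : (0 : ℂ) ∈ unitDisk := mem_ball_self one_pos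

theorem mem_unitDisk_iff {z : ℂ} : z ∈ unitDisk ↔ ‖z‖ < 1 := mem_ball_zero_iff

theorem isPreconnected_unitDisk : IsPreconnected unitDisk := (convex_ball (0 : ℂ) 1).isPreconnected

theorem mem_unitDisk_of_norm_le {z w : ℂ} (hz : z ∈ unitDisk) (hw : ‖w‖ ≤ ‖z‖) : w ∈ unitDisk :=
  mem_unitDisk_iff.2 (hw.trans_lt (mem_unitDisk_iff.1 hz))

theorem _root_.DifferentiableOn.hasDerivAt_unitDisk {f : ℂ → ℂ} (hf : DifferentiableOn ℂ f unitDisk)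
    {z : ℂ} (hz : z ∈ unitDisk) : HasDerivAt f (deriv f z) z :=
  (hf.differentiableAt (isOpen_unitDisk.mem_nhds hz)).hasDerivAt

theorem zero_mem_closure_unitDisk_diff : (0 : ℂ) ∈ closure (unitDisk \ {0}) := by
  have h : (𝓝[≠] (0 : ℂ)).NeBot := inferInstance
  rw [mem_closure_iff_nhdsWithin_neBot]
  refine h.mono (le_inf nhdsWithin_le_nhds ?_)
  rw [le_principal_iff]
  exact inter_mem (mem_nhdsWithin_of_mem_nhds (isOpen_unitDisk.mem_nhds zero_mem_unitDisk))
    self_mem_nhdsWithin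

/-- A closed condition on a continuous function extends from the punctured disk to the disk. -/
theorem forall_mem_of_punctured {g : ℂ → ℂ} (hg : ContinuousOn g unitDisk) {C : Set ℂ}
    (hC : IsClosed C) (h : ∀ z ∈ unitDisk, z ≠ 0 → g z ∈ C) {z : ℂ} (hz : z ∈ unitDisk) :
    g z ∈ C := by
  by_cases h0 : z = 0
  · subst h0
    have hc : ContinuousWithinAt g (unitDisk \ {0}) 0 := (hg 0 hz).mono sdiff_subset
    have := hc.mem_closure zero_mem_closure_unitDisk_diff (t := C)
      (fun w hw => h w hw.1 hw.2)
    rwa [hC.closure_eq] at this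
  · exact h z hz h0

/-! ### Comparison of primitives on the disk. -/

/-- The equation `2 η + z η' = h` has a holomorphic solution: `z² η` is a primitive of `z h`. -/
theorem exists_two_mul_add_mul_deriv_eq {h : ℂ → ℂ} (hh : DifferentiableOn ℂ h unitDisk) :
    ∃ η, DifferentiableOn ℂ η unitDisk ∧ ∀ z ∈ unitDisk, 2 * η z + z * deriv η z = h z := by
  have hzh : DifferentiableOn ℂ (fun z => z * h z) unitDisk := differentiableOn_id.mul hh
  obtain ⟨F, hF0, hF⟩ := hzh.isExactOn_ball.with_val_at 0 0
  have hFd : DifferentiableOn ℂ F unitDisk :=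
    fun z hz => (hF z hz).differentiableAt.differentiableWithinAt
  have hn := isOpen_unitDisk.mem_nhds zero_mem_unitDisk
  -- `F` vanishes to order two at `0`, so two divided differences produce `F / z²`.
  set F₁ := dslope F 0 with hF₁
  have hd₁ : DifferentiableOn ℂ F₁ unitDisk := (Complex.differentiableOn_dslope hn).2 hFd
  set η := dslope F₁ 0 with hη
  have hd₂ : DifferentiableOn ℂ η unitDisk := (Complex.differentiableOn_dslope hn).2 hd₁
  have h1 : F₁ 0 = 0 := by
    rw [hF₁, dslope_same, (hF 0 zero_mem_unitDisk).deriv, zero_mul]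
  have e : ∀ z, F z = z ^ 2 * η z := by
    intro z
    have a := sub_smul_dslope F 0 z
    have b := sub_smul_dslope F₁ 0 z
    simp only [sub_zero, smul_eq_mul, hF0, h1] at a b
    rw [← a, ← hF₁, ← b]
    ring
  refine ⟨η, hd₂, fun z hz => ?_⟩
  have hcont : ContinuousOn (fun z => 2 * η z + z * deriv η z - h z) unitDisk :=
    (((hd₂.const_mul 2).add (differentiableOn_id.mul (hd₂.deriv isOpen_unitDisk))).sub hh).continuousOn
  refine sub_eq_zero.1 (forall_mem_of_punctured hcont (isClosed_singleton (x := (0 : ℂ))) ?_ hz)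
  intro w hw hw0
  have e1 : HasDerivAt (fun z => z ^ 2 * η z) (2 * w * η w + w ^ 2 * deriv η w) w := by
    refine ((hasDerivAt_pow 2 w).mul (hd₂.hasDerivAt_unitDisk hw)).congr_deriv ?_
    simp
  have e2 := (hF w hw).unique (e1.congr_of_eventuallyEq (Eventually.of_forall e))
  refine mul_left_cancel₀ hw0 ?_
  linear_combination -e2

/-- If `Re q` attains its maximum over a closed disk about `0` at a boundary point `z`,
then `z q'(z)` is real and nonnegative. -/
theorem mul_deriv_of_isMax_re {q : ℂ → ℂ} {z q' : ℂ} (hq : HasDerivAt q q' z)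
    (hmax : ∀ w, ‖w‖ ≤ ‖z‖ → (q w).re ≤ (q z).re) : (z * q').im = 0 ∧ 0 ≤ (z * q').re := by
  constructor
  -- Along the circle `|w| = ‖z‖` the derivative of `Re q` at the maximum is `Re (i z q') = 0`.
  · have h1 : HasDerivAt (fun t : ℂ => z * Complex.exp (t * Complex.I)) (z * Complex.I)
        ((0 : ℝ) : ℂ) := by
      have := (((hasDerivAt_id ((0 : ℝ) : ℂ)).mul_const Complex.I).cexp).const_mul z
      simpa using this
    have hq1 : HasDerivAt q q' (z * Complex.exp (((0 : ℝ) : ℂ) * Complex.I)) := by simpa using hq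
    have h2 := (HasDerivAt.comp (h₂ := q)
      (h := fun t : ℂ => z * Complex.exp (t * Complex.I)) ((0 : ℝ) : ℂ) hq1 h1).real_of_complex
    have hm : IsLocalMax (fun t : ℝ => ((q ∘ fun t : ℂ => z * Complex.exp (t * Complex.I)) t).re) 0 := by
      refine Eventually.of_forall fun t => ?_
      have := hmax (z * Complex.exp (t * Complex.I)) (by simp [Complex.norm_exp_ofReal_mul_I])
      simpa using this
    have := hm.hasDerivAt_eq_zero h2
    have e : q' * (z * Complex.I) = (z * q') * Complex.I := by ring
    rw [e, Complex.mul_I_re] at this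
    linarith
  -- Along the radius, difference quotients from the inside are nonnegative.
  · have h1 : HasDerivAt (fun t : ℂ => z * t) z ((1 : ℝ) : ℂ) := by
      simpa using (hasDerivAt_id ((1 : ℝ) : ℂ)).const_mul z
    have hq1 : HasDerivAt q q' (z * ((1 : ℝ) : ℂ)) := by simpa using hq
    have h2 := (HasDerivAt.comp (h₂ := q) (h := fun t : ℂ => z * t) ((1 : ℝ) : ℂ)
      hq1 h1).real_of_complex
    have h3 := (hasDerivWithinAt_iff_tendsto_slope' self_notMem_Iio).1
      (h2.hasDerivWithinAt (s := Iio 1))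
    refine ge_of_tendsto (mul_comm q' z ▸ h3) ?_
    have : Ioo (0 : ℝ) 1 ∈ 𝓝[<] (1 : ℝ) := Ioo_mem_nhdsLT one_pos
    filter_upwards [this] with t ht
    rw [slope_def_field]
    refine div_nonneg_of_nonpos ?_ (by linarith [ht.2])
    have := hmax (z * t) (by
      rw [norm_mul, Complex.norm_real, Real.norm_of_nonneg ht.1.le]
      exact mul_le_of_le_one_right (norm_nonneg _) ht.2.le)
    simpa using this

/-- If `1 = z m' + m K` with `Re K > 0`, then `Re m > 0`. -/
theorem re_pos_of_mul_deriv_add {m K : ℂ → ℂ} (hm : DifferentiableOn ℂ m unitDisk)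
    (hK : ∀ z ∈ unitDisk, 0 < (K z).re) (h : ∀ z ∈ unitDisk, z * deriv m z + m z * K z = 1)
    {z : ℂ} (hz : z ∈ unitDisk) : 0 < (m z).re := by
  by_contra! hneg
  have hsub : closedBall (0 : ℂ) ‖z‖ ⊆ unitDisk := fun w hw =>
    mem_unitDisk_of_norm_le hz (by simpa using hw)
  have hcont : ContinuousOn (fun w => (m w).re) (closedBall (0 : ℂ) ‖z‖) :=
    Complex.continuous_re.comp_continuousOn (hm.continuousOn.mono hsub)
  have hcl : IsClosed (closedBall (0 : ℂ) ‖z‖ ∩ (fun w => (m w).re) ⁻¹' Iic 0) :=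
    hcont.preimage_isClosed_of_isClosed isClosed_closedBall isClosed_Iic
  have hcpt : IsCompact (closedBall (0 : ℂ) ‖z‖ ∩ (fun w => (m w).re) ⁻¹' Iic 0) :=
    (isCompact_closedBall (0 : ℂ) ‖z‖).of_isClosed_subset hcl inter_subset_left
  -- `w` is a point of least modulus with `Re m ≤ 0`. If `w ≠ 0`, then `Re m(w) = 0` and `-m` has
  -- maximal real part there, so `w m'(w)` is real and `≤ 0`.
  obtain ⟨w, ⟨hw1, hw2⟩, hwmin⟩ := hcpt.exists_isMinOn ⟨z, by simp, hneg⟩ continuous_norm.continuousOn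
  have hwD : w ∈ unitDisk := hsub hw1
  have hw1' : ‖w‖ ≤ ‖z‖ := by simpa using hw1
  have hlt : ∀ v, ‖v‖ < ‖w‖ → 0 < (m v).re := by
    intro v hv
    by_contra! hv'
    have : ‖w‖ ≤ ‖v‖ := hwmin ⟨by simpa using hv.le.trans hw1', hv'⟩
    linarith
  have hle : ∀ v, ‖v‖ ≤ ‖w‖ → 0 < ‖w‖ → 0 ≤ (m v).re := by
    intro v hv hw0
    have hc : ContinuousWithinAt (fun u => (m u).re) (ball (0 : ℂ) ‖w‖) v :=
      (hcont v (by simpa using hv.trans hw1')).mono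
        (ball_subset_closedBall.trans (closedBall_subset_closedBall hw1'))
    have hv' : v ∈ closure (ball (0 : ℂ) ‖w‖) := by
      rw [closure_ball _ hw0.ne']; simpa using hv
    have := hc.mem_closure hv' (t := Ici 0) (fun u hu => (hlt u (by simpa using hu)).le)
    simpa using this
  have hw2' : (m w).re ≤ 0 := hw2
  have hE := h w hwD
  by_cases h0 : w = 0
  · subst h0
    have hk := hK 0 hwD
    rw [zero_mul, zero_add] at hE
    have : m 0 = (K 0)⁻¹ := eq_inv_of_mul_eq_one_left hE
    rw [this, Complex.inv_re] at hw2'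
    have hp : 0 < (K 0).re / Complex.normSq (K 0) :=
      div_pos hk (Complex.normSq_pos.2 fun hh => by simp [hh] at hk)
    linarith
  · have hw0 : 0 < ‖w‖ := norm_pos_iff.2 h0
    have hz0 : (m w).re = 0 := le_antisymm hw2' (hle w le_rfl hw0)
    have hd := (hm.hasDerivAt_unitDisk hwD).neg
    obtain ⟨hi, hr⟩ := mul_deriv_of_isMax_re hd (q := fun u => -m u) (z := w) (by
      intro v hv
      simpa [hz0] using hle v hv hw0)
    rw [mul_neg, Complex.neg_im] at hi
    rw [mul_neg, Complex.neg_re] at hr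
    have him := congrArg Complex.im hE
    have hre := congrArg Complex.re hE
    rw [Complex.add_im, Complex.mul_im (m w), hz0, Complex.one_im] at him
    rw [Complex.add_re, Complex.mul_re (m w), hz0, Complex.one_re] at hre
    -- With `Re K > 0` this forces `m(w) = 0`, and then `w m'(w) = 1` contradicts `w m'(w) ≤ 0`.
    have : (m w).im * (K w).re = 0 := by linarith
    rcases mul_eq_zero.1 this with h' | h'
    · rw [h'] at hre
      linarith
    · linarith [hK w hwD]

/-- If `Re (q + m z q') ≤ 0` with `Re m > 0`, then `Re q ≤ 0`. -/
theorem re_nonpos_of_add_mul_deriv {q m : ℂ → ℂ} (hq : DifferentiableOn ℂ q unitDisk)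
    (hm : ∀ z ∈ unitDisk, 0 < (m z).re)
    (h : ∀ z ∈ unitDisk, (q z + z * deriv q z * m z).re ≤ 0)
    {z : ℂ} (hz : z ∈ unitDisk) : (q z).re ≤ 0 := by
  by_contra! hpos
  have hsub : closedBall (0 : ℂ) ‖z‖ ⊆ unitDisk := fun w hw =>
    mem_unitDisk_of_norm_le hz (by simpa using hw)
  have hcont : ContinuousOn (fun w => (q w).re) (closedBall (0 : ℂ) ‖z‖) :=
    Complex.continuous_re.comp_continuousOn (hq.continuousOn.mono hsub)
  obtain ⟨w, hw, hmax⟩ := (isCompact_closedBall (0 : ℂ) ‖z‖).exists_isMaxOn ⟨z, by simp⟩ hcont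
  have hw1 : ‖w‖ ≤ ‖z‖ := by simpa using hw
  have hzw : (q z).re ≤ (q w).re := hmax (by simp)
  -- At the maximum `w q'` is real and `≥ 0`, so the term `w q' m` can only increase the real part.
  obtain ⟨hi, hr⟩ := mul_deriv_of_isMax_re (hq.hasDerivAt_unitDisk (hsub hw))
    (fun v hv => hmax (by simpa using hv.trans hw1))
  have h1 := h w (hsub hw)
  rw [Complex.add_re, Complex.mul_re (w * deriv q w), hi] at h1
  nlinarith [mul_nonneg hr (hm w (hsub hw)).le]

/-- A comparison principle for primitives: here `z² η` and `z² κ` are the primitives of `z h` and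
`z d`, the first of which is locally univalent in `z²` and convex. -/
theorem comparison {h d η κ : ℂ → ℂ} (hh : DifferentiableOn ℂ h unitDisk)
    (hη : DifferentiableOn ℂ η unitDisk) (hκ : DifferentiableOn ℂ κ unitDisk)
    (hηh : ∀ z ∈ unitDisk, 2 * η z + z * deriv η z = h z)
    (hκd : ∀ z ∈ unitDisk, 2 * κ z + z * deriv κ z = d z)
    (h0 : ∀ z ∈ unitDisk, h z ≠ 0) (hK : ∀ z ∈ unitDisk, 0 < (2 + z * deriv h z / h z).re)
    (hd : ∀ z ∈ unitDisk, (d z / h z).re ≤ 0) :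
    (∀ z ∈ unitDisk, η z ≠ 0) ∧ (∀ z ∈ unitDisk, (κ z / η z).re ≤ 0) ∧
      ∀ z ∈ unitDisk, κ z = 0 → ∀ w ∈ unitDisk, κ w = 0 := by
  have hm : ∀ z ∈ unitDisk, 0 < (η z / h z).re := by
    intro z hz
    -- With `H = z² η` this quotient is `H / (z H')`, and `K = 1 + z H'' / H'`: convexity implies
    -- starlikeness.
    refine re_pos_of_mul_deriv_add (m := fun z => η z / h z) (hη.div hh h0) hK ?_ hz
    intro w hw
    have hw0 := h0 w hw
    have e := ((hη.hasDerivAt_unitDisk hw).div (hh.hasDerivAt_unitDisk hw) hw0).deriv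
    change w * deriv (η / h) w + _ = 1
    rw [e]
    field_simp
    linear_combination h w * hηh w hw
  have hη0 : ∀ z ∈ unitDisk, η z ≠ 0 := by
    intro z hz he
    have := hm z hz
    rw [he, zero_div, Complex.zero_re] at this
    exact this.false
  have hq : DifferentiableOn ℂ (fun z => κ z / η z) unitDisk := hκ.div hη hη0
  have hre : ∀ z ∈ unitDisk, (κ z / η z).re ≤ 0 := by
    intro z hz
    -- For `D = z² κ` and `q = D / H`, the quotient `d / h = D' / H'` equals `q + (H / (z H')) z
    -- q'`.
    refine re_nonpos_of_add_mul_deriv (q := fun z => κ z / η z) hq hm ?_ hz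
    intro w hw
    have hw0 := h0 w hw
    have hw1 := hη0 w hw
    have e := ((hκ.hasDerivAt_unitDisk hw).div (hη.hasDerivAt_unitDisk hw) hw1).deriv
    convert hd w hw using 2
    change _ + w * deriv (κ / η) w * _ = _
    rw [e]
    field_simp
    linear_combination η w * hκd w hw - κ w * hηh w hw
  refine ⟨hη0, hre, fun z hz hκz w hw => ?_⟩
  have hone : ∀ u ∈ unitDisk, 1 ≤ ‖1 - κ u / η u‖ := by
    intro u hu
    refine le_trans ?_ (Complex.re_le_norm _)
    rw [Complex.sub_re, Complex.one_re]
    linarith [hre u hu]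
  have hne : ∀ u ∈ unitDisk, 1 - κ u / η u ≠ 0 := fun u hu he => by
    have := hone u hu
    rw [he, norm_zero] at this
    linarith
  -- This function has modulus at most `1` and takes the value `1` at a zero of `κ`.
  have hmax := Complex.eqOn_of_isPreconnected_of_isMaxOn_norm (f := fun u => (1 - κ u / η u)⁻¹)
    isPreconnected_unitDisk isOpen_unitDisk ((hq.const_sub 1).inv hne) hz (by
      intro u hu
      simp only [mem_ofPred_eq, Function.comp, norm_inv, hκz, zero_div, sub_zero, norm_one, inv_one]
      exact inv_le_one_of_one_le₀ (hone u hu))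
  have := hmax hw
  simp only [Function.const, hκz, zero_div, sub_zero, inv_one] at this
  have h2 : κ w / η w = 0 := by
    have h3 := inv_eq_one.1 this
    linear_combination -h3
  exact (div_eq_zero_iff.1 h2).resolve_right (hη0 w hw)

/-! ### Estimates for the extremal integrand. -/

theorem re_div_nonpos {z w : ℂ} (h : z.re * w.re + z.im * w.im ≤ 0) : (z / w).re ≤ 0 := by
  rw [Complex.div_re, ← add_div]
  exact div_nonpos_of_nonpos_of_nonneg h (Complex.normSq_nonneg w)

theorem re_div_pos {z w : ℂ} (h : 0 < z.re * w.re + z.im * w.im) : 0 < (z / w).re := by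
  rw [Complex.div_re, ← add_div]
  refine div_pos h (Complex.normSq_pos.2 ?_)
  rintro rfl
  simp at h

theorem norm_le_norm_of_sq {z w : ℂ} (h : z.re ^ 2 + z.im ^ 2 ≤ w.re ^ 2 + w.im ^ 2) :
    ‖z‖ ≤ ‖w‖ := by
  rw [← sq_le_sq₀ (norm_nonneg _) (norm_nonneg _), Complex.sq_norm, Complex.sq_norm,
    Complex.normSq_apply, Complex.normSq_apply]
  linarith

theorem norm_lt_norm_of_sq {z w : ℂ} (h : z.re ^ 2 + z.im ^ 2 < w.re ^ 2 + w.im ^ 2) :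
    ‖z‖ < ‖w‖ := by
  rw [← sq_lt_sq₀ (norm_nonneg _) (norm_nonneg _), Complex.sq_norm, Complex.sq_norm,
    Complex.normSq_apply, Complex.normSq_apply]
  linarith

theorem sq_add_sq_le_one {z : ℂ} (h : ‖z‖ ≤ 1) : z.re ^ 2 + z.im ^ 2 ≤ 1 := by
  have := pow_le_one₀ (n := 2) (norm_nonneg z) h
  rw [Complex.sq_norm, Complex.normSq_apply] at this
  linarith

theorem sq_add_sq_lt_one {z : ℂ} (h : ‖z‖ < 1) : z.re ^ 2 + z.im ^ 2 < 1 := by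
  have := pow_lt_one₀ (norm_nonneg z) h two_ne_zero
  rw [Complex.sq_norm, Complex.normSq_apply] at this
  linarith

/-- `(1 + λ g z) (1 - z δ(g z, λ))`. -/
noncomputable def extremalDenom (g : ℂ) (lam : ℝ) (z : ℂ) : ℂ := 1 + lam * (g - 1) * z - g * z ^ 2

section Estimates

variable {lam : ℝ} {z g : ℂ}

theorem one_add_lam_mul_ne_zero (hl0 : 0 ≤ lam) (hl1 : lam < 1) {w : ℂ} (hw : ‖w‖ ≤ 1) :
    1 + lam * w ≠ 0 := by
  intro h
  have h1 : ‖(lam : ℂ) * w‖ < 1 := by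
    rw [norm_mul, Complex.norm_real, Real.norm_of_nonneg hl0]
    exact (mul_le_of_le_one_right hl0 hw).trans_lt hl1
  have h2 : (lam : ℂ) * w = -1 := by linear_combination h
  rw [h2, norm_neg, norm_one] at h1
  exact h1.false

/-- `|1 + λw|² - |w + λ|² = (1 - λ²)(1 - |w|²)`. -/
theorem norm_add_lam_le (hl0 : 0 ≤ lam) (hl1 : lam < 1) {w : ℂ} (hw : ‖w‖ ≤ 1) :
    ‖w + lam‖ ≤ ‖1 + lam * w‖ := by
  apply norm_le_norm_of_sq
  have := sq_add_sq_le_one hw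
  simp
  nlinarith [mul_nonneg (sub_nonneg.2 this) (show 0 ≤ 1 - lam ^ 2 by nlinarith)]

theorem norm_sub_lam_le (hl0 : 0 ≤ lam) (hl1 : lam < 1) {w : ℂ} (hw : ‖w‖ ≤ 1) :
    ‖w - lam‖ ≤ ‖1 - lam * w‖ := by
  have := norm_add_lam_le hl0 hl1 (w := -w) (by simpa using hw)
  rw [← norm_neg]
  simpa [sub_eq_add_neg, add_comm] using this

theorem one_sub_lam_mul_ne_zero (hl0 : 0 ≤ lam) (hl1 : lam < 1) {w : ℂ} (hw : ‖w‖ ≤ 1) :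
    1 - lam * w ≠ 0 := by
  have := one_add_lam_mul_ne_zero hl0 hl1 (w := -w) (by simpa using hw)
  simpa [sub_eq_add_neg] using this

theorem norm_mul_add_lam_lt (hl0 : 0 ≤ lam) (hl1 : lam < 1) (hz : z ∈ unitDisk) (hg : ‖g‖ ≤ 1) :
    ‖z * (g * z + lam)‖ < ‖1 + lam * (g * z)‖ := by
  have hz' := mem_unitDisk_iff.1 hz
  have hgz : ‖g * z‖ ≤ 1 := by
    rw [norm_mul]
    exact mul_le_one₀ hg (norm_nonneg _) hz'.le
  have h1 := norm_pos_iff.2 (one_add_lam_mul_ne_zero hl0 hl1 hgz)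
  rw [norm_mul]
  calc ‖z‖ * ‖g * z + lam‖ ≤ ‖z‖ * ‖1 + lam * (g * z)‖ := by
        gcongr
        exact norm_add_lam_le hl0 hl1 hgz
    _ < 1 * ‖1 + lam * (g * z)‖ := by gcongr
    _ = _ := one_mul _

theorem extremalDenom_ne_zero (hl0 : 0 ≤ lam) (hl1 : lam < 1) (hz : z ∈ unitDisk) (hg : ‖g‖ ≤ 1) :
    extremalDenom g lam z ≠ 0 := by
  intro h
  have h1 := norm_mul_add_lam_lt hl0 hl1 hz hg
  have : 1 + lam * (g * z) = z * (g * z + lam) := by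
    rw [extremalDenom] at h
    linear_combination h
  rw [this] at h1
  exact h1.false

theorem re_add_div_sub_pos {M N : ℂ} (h : ‖M‖ < ‖N‖) : 0 < ((N + M) / (N - M)).re := by
  apply re_div_pos
  have := pow_lt_pow_left₀ h (norm_nonneg _) two_ne_zero
  rw [Complex.sq_norm, Complex.sq_norm, Complex.normSq_apply, Complex.normSq_apply] at this
  simp
  nlinarith

/-- With `M = z (g z + λ)` and `N = 1 + λ g z`, adding `1` turns the quotient into the Cayley
transform `(N + M) / (N - M)`, where `|M| < |N|`. -/
theorem re_mul_div_extremalDenom (hl0 : 0 ≤ lam) (hl1 : lam < 1) (hz : z ∈ unitDisk)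
    (hg : ‖g‖ ≤ 1) : -1 < (2 * (z * (g * z + lam)) / extremalDenom g lam z).re := by
  have h1 := re_add_div_sub_pos (norm_mul_add_lam_lt hl0 hl1 hz hg)
  have h0 := extremalDenom_ne_zero hl0 hl1 hz hg
  have e : 1 + lam * (g * z) - z * (g * z + lam) = extremalDenom g lam z := by
    rw [extremalDenom]; ring
  have e2 : 1 + lam * (g * z) + z * (g * z + lam)
      = extremalDenom g lam z + 2 * (z * (g * z + lam)) := by
    rw [extremalDenom]; ring
  rw [e, e2, add_div, div_self h0, Complex.add_re, Complex.one_re] at h1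
  linarith

theorem extremalIntegrand_eq (hl0 : 0 ≤ lam) (hl1 : lam < 1) (hz : z ∈ unitDisk) (hg : ‖g‖ ≤ 1)
    (β : ℝ) : extremalIntegrand g lam β z
      = 2 * (1 - (β : ℂ)) * ((g * z + lam) / extremalDenom g lam z) := by
  have hgz : ‖g * z‖ ≤ 1 := by
    rw [norm_mul]
    exact mul_le_one₀ hg (norm_nonneg _) (mem_unitDisk_iff.1 hz).le
  have h1 := one_add_lam_mul_ne_zero hl0 hl1 hgz
  have h0 := extremalDenom_ne_zero hl0 hl1 hz hg
  have e : 1 - z * delta (g * z) lam = extremalDenom g lam z / (1 + lam * (g * z)) := by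
    rw [delta, extremalDenom, eq_div_iff h1, sub_mul, mul_assoc, div_mul_cancel₀ _ h1]
    ring
  rw [extremalIntegrand, e, delta, ← mul_div_assoc, div_div_div_cancel_right₀ h1, mul_div_assoc]

/-- Twice the real part of `(c - 1)(1 + b)` times the conjugate of `1 + bc` is `-(1 - |b|²)|c - 1|²
- (1 - |c|²)|1 + b|²`. -/
theorem re_comparison_aux {b c : ℂ} (hb : ‖b‖ ≤ 1) (hc : ‖c‖ ≤ 1) :
    ((c - 1) * (1 + b) / (1 + b * c)).re ≤ 0 := by
  apply re_div_nonpos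
  have h1 := sq_add_sq_le_one hb
  have h2 := sq_add_sq_le_one hc
  simp
  nlinarith [mul_nonneg (sub_nonneg.2 h1) (add_nonneg (sq_nonneg (c.re - 1)) (sq_nonneg c.im)),
    mul_nonneg (sub_nonneg.2 h2) (add_nonneg (sq_nonneg (b.re + 1)) (sq_nonneg b.im))]

/-- The denominator is affine in `g`: it is `(1 - λz) + g z (λ - z)`. Dividing by `1 - λz` reduces
to `re_comparison_aux` with `b = a z (λ - z) / (1 - λz)` and `c = g / a`. -/
theorem re_sub_mul_div_nonpos (hl0 : 0 ≤ lam) (hl1 : lam < 1) (hz : z ∈ unitDisk) {a : ℂ}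
    (ha : ‖a‖ = 1) (hg : ‖g‖ ≤ 1) :
    ((g - a) * extremalDenom a lam z / (a * extremalDenom g lam z)).re ≤ 0 := by
  have hz' := mem_unitDisk_iff.1 hz
  have ha0 : a ≠ 0 := norm_pos_iff.1 (by rw [ha]; exact one_pos)
  have hA := one_sub_lam_mul_ne_zero hl0 hl1 hz'.le
  have hQ := extremalDenom_ne_zero hl0 hl1 hz hg
  have hb : ‖z * (lam - z) * a / (1 - lam * z)‖ ≤ 1 := by
    rw [norm_div, norm_mul, norm_mul, ha, mul_one, div_le_one (norm_pos_iff.2 hA), norm_sub_rev]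
    exact (mul_le_of_le_one_left (norm_nonneg _) hz'.le).trans (norm_sub_lam_le hl0 hl1 hz'.le)
  have hc : ‖g / a‖ ≤ 1 := by rwa [norm_div, ha, div_one]
  convert re_comparison_aux hb hc using 2
  have e : 1 + z * (lam - z) * a / (1 - lam * z) * (g / a)
      = extremalDenom g lam z / (1 - lam * z) := by
    rw [extremalDenom]
    generalize hS : 1 - lam * z = S at hA
    field_simp
    rw [← hS]
    ring
  have e2 : 1 + z * (lam - z) * a / (1 - lam * z)
      = extremalDenom a lam z / (1 - lam * z) := by
    rw [extremalDenom]
    generalize hS : 1 - lam * z = S at hA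
    field_simp
    rw [← hS]
    ring
  rw [e, e2]
  field_simp

/-- This is the convexity estimate: for `h = a / P²` one has `2 + z h' / h = 2 (1 + a z²) / P`. -/
theorem re_one_add_div_extremalDenom_pos (hl0 : 0 ≤ lam) (hl1 : lam < 1) (hz : z ∈ unitDisk) {a : ℂ}
    (ha : ‖a‖ = 1) : 0 < ((1 + a * z ^ 2) / extremalDenom a lam z).re := by
  have hz' := sq_add_sq_lt_one (mem_unitDisk_iff.1 hz)
  obtain ⟨u, hu⟩ : ∃ u, u = a * z := ⟨_, rfl⟩
  have hn : u.re ^ 2 + u.im ^ 2 = z.re ^ 2 + z.im ^ 2 := by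
    have : ‖u‖ ^ 2 = ‖z‖ ^ 2 := by rw [hu, norm_mul, ha, one_mul]
    rw [Complex.sq_norm, Complex.sq_norm, Complex.normSq_apply, Complex.normSq_apply] at this
    linarith
  have e1 : 1 + a * z ^ 2 = 1 + u * z := by rw [hu]; ring
  have e2 : extremalDenom a lam z = 1 + lam * (u - z) - u * z := by rw [hu, extremalDenom]; ring
  rw [e1, e2]
  apply re_div_pos
  simp
  generalize u.re = s, u.im = t, z.re = p, z.im = q at *
  -- As `|u| = |z|`, the real part of `(1 + uz)` times the conjugate denominator factors as this
  -- product.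
  have key : 0 < (1 - (p ^ 2 + q ^ 2)) * (1 + (p ^ 2 + q ^ 2) + lam * (s - p)) := by
    refine mul_pos (by linarith) ?_
    have h3 : p - s ≤ 1 + (p ^ 2 + q ^ 2) := by nlinarith [sq_nonneg (s + 1), sq_nonneg (p - 1)]
    have h4 : 0 < 1 + (p ^ 2 + q ^ 2) := by positivity
    rcases le_or_gt (p - s) 0 with h | h
    · nlinarith
    · nlinarith
  have h5 : (1 + (s * p - t * q)) * (1 + lam * (s - p) - (s * p - t * q)) +
      (s * q + t * p) * (lam * (t - q) - (s * q + t * p)) =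
      1 - (s ^ 2 + t ^ 2) * (p ^ 2 + q ^ 2)
        + lam * ((s - p) + (s ^ 2 + t ^ 2) * p - (p ^ 2 + q ^ 2) * s) := by ring
  rw [h5, hn]
  nlinarith

end Estimates

/-! ### Segment integrals and the class of logarithms. -/

theorem hasDerivAt_segmentIntegral {φ : ℂ → ℂ} (hφ : DifferentiableOn ℂ φ unitDisk) {z : ℂ}
    (hz : z ∈ unitDisk) : HasDerivAt (segmentIntegral φ) (φ z) z := by
  obtain ⟨Φ, hΦ⟩ := hφ.isExactOn_ball
  have e : ∀ w ∈ unitDisk, segmentIntegral φ w = Φ w - Φ 0 := by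
    intro w hw
    have hmem : ∀ t ∈ uIcc (0 : ℝ) 1, (t : ℂ) * w ∈ unitDisk := by
      intro t ht
      rw [uIcc_of_le zero_le_one] at ht
      refine mem_unitDisk_of_norm_le hw ?_
      rw [norm_mul, Complex.norm_real, Real.norm_of_nonneg ht.1]
      exact mul_le_of_le_one_left (norm_nonneg _) ht.2
    have hd : ∀ t ∈ uIcc (0 : ℝ) 1,
        HasDerivAt (fun t : ℝ => Φ ((t : ℂ) * w)) (φ ((t : ℂ) * w) * w) t := by
      intro t ht
      have h1 : HasDerivAt (fun s : ℂ => s * w) w (t : ℂ) := by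
        simpa using (hasDerivAt_id (t : ℂ)).mul_const w
      exact (HasDerivAt.comp (h₂ := Φ) (h := fun s : ℂ => s * w) (t : ℂ)
        (hΦ _ (hmem t ht)) h1).comp_ofReal
    rw [segmentIntegral, intervalIntegral.integral_eq_sub_of_hasDerivAt hd]
    · simp
    · apply ContinuousOn.intervalIntegrable
      refine ContinuousOn.mul (hφ.continuousOn.comp ?_ hmem) continuousOn_const
      fun_prop
  exact ((hΦ z hz).sub_const (Φ 0)).congr_of_eventuallyEq
    (eventually_of_mem (isOpen_unitDisk.mem_nhds hz) e)

theorem differentiableOn_segmentIntegral {φ : ℂ → ℂ} (hφ : DifferentiableOn ℂ φ unitDisk) :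
    DifferentiableOn ℂ (segmentIntegral φ) unitDisk :=
  fun _ hz => (hasDerivAt_segmentIntegral hφ hz).differentiableAt.differentiableWithinAt

theorem segmentIntegral_zero (φ : ℂ → ℂ) : segmentIntegral φ 0 = 0 := by simp [segmentIntegral]

/-- The functions `log f'` for `f ∈ 𝓕(λ)`. -/
structure IsLogClass (β lam : ℝ) (L : ℂ → ℂ) : Prop where
  analytic : DifferentiableOn ℂ L unitDisk
  map_zero : L 0 = 0
  deriv_zero : deriv L 0 = 2 * (lam : ℂ) * (1 - (β : ℂ))
  re_gt : ∀ z ∈ unitDisk, β - 1 < (z * deriv L z).re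

variable {β lam : ℝ}

theorem IsLogBranch.deriv_eq {g L : ℂ → ℂ} (h : IsLogBranch g L) {z : ℂ} (hz : z ∈ unitDisk) :
    deriv g z = g z * deriv L z := by
  have h1 : HasDerivAt g (Complex.exp (L z) * deriv L z) z :=
    (h.analytic.hasDerivAt_unitDisk hz).cexp.congr_of_eventuallyEq
      (eventually_of_mem (isOpen_unitDisk.mem_nhds hz) fun w hw => (h.exp_eq w hw).symm)
  rw [h1.deriv, h.exp_eq z hz]

theorem isLogClass_logBranch {f : ℂ → ℂ} (hf : f ∈ classF β lam) :
    IsLogClass β lam (logBranch (deriv f)) := by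
  obtain ⟨hF, h2⟩ := hf
  have hL := hF.isLogBranch
  refine ⟨hL.analytic, hL.map_zero, ?_, fun z hz => ?_⟩
  · rw [← h2, hL.deriv_eq zero_mem_unitDisk, hF.deriv_zero, one_mul]
  · have := hF.re_gt z hz
    rw [hL.deriv_eq hz, mul_left_comm, mul_div_cancel_left₀ _ (hF.deriv_ne_zero z hz),
      Complex.add_re, Complex.one_re] at this
    linarith

theorem isLogBranch_deriv_segmentIntegral_exp {L : ℂ → ℂ} (hL : DifferentiableOn ℂ L unitDisk)
    (h0 : L 0 = 0) :
    IsLogBranch (deriv (segmentIntegral fun z => Complex.exp (L z))) L :=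
  ⟨hL, h0, fun _ hz => (hasDerivAt_segmentIntegral hL.cexp hz).deriv.symm⟩

theorem IsLogClass.segmentIntegral_exp_mem {L : ℂ → ℂ} (hL : IsLogClass β lam L) :
    (segmentIntegral fun z => Complex.exp (L z)) ∈ classF β lam := by
  have hB := isLogBranch_deriv_segmentIntegral_exp hL.analytic hL.map_zero
  have hne : ∀ z ∈ unitDisk, deriv (segmentIntegral fun z => Complex.exp (L z)) z ≠ 0 := by
    intro z hz
    rw [← hB.exp_eq z hz]
    exact Complex.exp_ne_zero _
  have h1 : deriv (segmentIntegral fun z => Complex.exp (L z)) 0 = 1 := by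
    rw [← hB.exp_eq 0 zero_mem_unitDisk, hL.map_zero, Complex.exp_zero]
  refine ⟨⟨differentiableOn_segmentIntegral hL.analytic.cexp, segmentIntegral_zero _, h1, hne,
    fun z hz => ?_⟩, ?_⟩
  · rw [hB.deriv_eq hz, mul_left_comm, mul_div_cancel_left₀ _ (hne z hz), Complex.add_re,
      Complex.one_re]
    linarith [hL.re_gt z hz]
  · rw [hB.deriv_eq zero_mem_unitDisk, h1, one_mul, hL.deriv_zero]

theorem logBranch_deriv_segmentIntegral_exp {L : ℂ → ℂ} (hL : DifferentiableOn ℂ L unitDisk)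
    (h0 : L 0 = 0) {z : ℂ} (hz : z ∈ unitDisk) :
    logBranch (deriv (segmentIntegral fun z => Complex.exp (L z))) z = L z := by
  have hB := isLogBranch_deriv_segmentIntegral_exp hL h0
  exact (isLogBranch_logBranch ⟨L, hB⟩).eqOn hB hz

theorem region_eq {z₀ : ℂ} (hz₀ : z₀ ∈ unitDisk) :
    region z₀ lam β = {w | ∃ L, IsLogClass β lam L ∧ w = L z₀} := by
  ext w
  constructor
  · rintro ⟨f, hf, rfl⟩
    exact ⟨_, isLogClass_logBranch hf, rfl⟩
  · rintro ⟨L, hL, rfl⟩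
    exact ⟨_, hL.segmentIntegral_exp_mem,
      (logBranch_deriv_segmentIntegral_exp hL.analytic hL.map_zero hz₀).symm⟩

theorem convex_region {z₀ : ℂ} (hz₀ : z₀ ∈ unitDisk) : Convex ℝ (region z₀ lam β) := by
  rw [region_eq hz₀]
  rintro _ ⟨L, hL, rfl⟩ _ ⟨M, hM, rfl⟩ s t hs ht hst
  have hd : ∀ z ∈ unitDisk, deriv (fun z => (s : ℂ) * L z + (t : ℂ) * M z) z
      = s * deriv L z + t * deriv M z := fun z hz =>
    (((hL.analytic.hasDerivAt_unitDisk hz).const_mul (s : ℂ)).add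
      ((hM.analytic.hasDerivAt_unitDisk hz).const_mul (t : ℂ))).deriv
  have hst' : (s : ℂ) + t = 1 := by exact_mod_cast hst
  refine ⟨fun z => s * L z + t * M z,
    ⟨(hL.analytic.const_mul _).add (hM.analytic.const_mul _), ?_, ?_, fun z hz => ?_⟩, ?_⟩
  · simp [hL.map_zero, hM.map_zero]
  · rw [hd 0 zero_mem_unitDisk, hL.deriv_zero, hM.deriv_zero, ← add_mul, hst', one_mul]
  · have e : z * (s * deriv L z + t * deriv M z)
        = (s : ℂ) * (z * deriv L z) + (t : ℂ) * (z * deriv M z) := by ring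
    rw [hd z hz, e, Complex.add_re, Complex.re_ofReal_mul, Complex.re_ofReal_mul]
    have h1 := hL.re_gt z hz
    have h2 := hM.re_gt z hz
    -- Strictness must come from a positive weight; if `s = 0`, it is `t = 1`.
    rcases hs.eq_or_lt with rfl | hs
    · have : t = 1 := by linarith
      subst this
      linarith
    · have h3 : (s + t) * (β - 1) = β - 1 := by rw [hst, one_mul]
      nlinarith [mul_pos hs (sub_pos.2 h1), mul_nonneg ht (sub_pos.2 h2).le]
  · simp

/-! ### Extremal functions and an interior point of the region. -/

theorem differentiableOn_extremalIntegrand (hl0 : 0 ≤ lam) (hl1 : lam < 1) {a : ℂ} (ha : ‖a‖ ≤ 1) :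
    DifferentiableOn ℂ (extremalIntegrand a lam β) unitDisk := by
  have h : DifferentiableOn ℂ
      (fun z => 2 * (1 - (β : ℂ)) * ((a * z + lam) / extremalDenom a lam z)) unitDisk := by
    refine DifferentiableOn.const_mul (DifferentiableOn.div (by fun_prop) ?_ fun z hz =>
      extremalDenom_ne_zero hl0 hl1 hz ha) _
    unfold extremalDenom
    fun_prop
  exact h.congr fun z hz => extremalIntegrand_eq hl0 hl1 hz ha β

theorem isLogClass_extremal (hβ1 : β < 1) (hl0 : 0 ≤ lam) (hl1 : lam < 1) {a : ℂ} (ha : ‖a‖ ≤ 1) :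
    IsLogClass β lam (segmentIntegral (extremalIntegrand a lam β)) := by
  have hφ := differentiableOn_extremalIntegrand (β := β) hl0 hl1 ha
  refine ⟨differentiableOn_segmentIntegral hφ, segmentIntegral_zero _, ?_, fun z hz => ?_⟩
  · rw [(hasDerivAt_segmentIntegral hφ zero_mem_unitDisk).deriv,
      extremalIntegrand_eq hl0 hl1 zero_mem_unitDisk ha, extremalDenom]
    simp
    ring
  · rw [(hasDerivAt_segmentIntegral hφ hz).deriv, extremalIntegrand_eq hl0 hl1 hz ha]
    have h := re_mul_div_extremalDenom hl0 hl1 hz ha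
    have e : z * (2 * (1 - (β : ℂ)) * ((a * z + lam) / extremalDenom a lam z))
        = ((1 - β : ℝ) : ℂ) * (2 * (z * (a * z + lam)) / extremalDenom a lam z) := by
      push_cast
      ring
    rw [e, Complex.re_ofReal_mul]
    nlinarith

/-- The quadratic perturbations of the extremal function with parameter `0` fill a disk. -/
theorem interior_region_nonempty (hβ1 : β < 1) (hl0 : 0 ≤ lam) (hl1 : lam < 1) {z₀ : ℂ}
    (hz₀ : z₀ ∈ unitDisk) (hz₀0 : z₀ ≠ 0) : (interior (region z₀ lam β)).Nonempty := by
  have ha : ‖(0 : ℂ)‖ ≤ 1 := by simp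
  have hL := isLogClass_extremal hβ1 hl0 hl1 ha
  have hφ := differentiableOn_extremalIntegrand (β := β) hl0 hl1 ha
  set L := segmentIntegral (extremalIntegrand 0 lam β) with hLdef
  -- For parameter `0`, `z L' = 2λ(1-β) z / (1 - λz)`, and `Re (z / (1 - λz)) ≥ -1 / (1 + λ)`. As
  -- `2λ / (1 + λ) < 1`, there is room for a perturbation.
  have hbound : ∀ z ∈ unitDisk, (β - 1) * (2 * lam / (1 + lam)) ≤ (z * deriv L z).re := by
    intro z hz
    have hz' := mem_unitDisk_iff.1 hz
    have h0 := one_sub_lam_mul_ne_zero hl0 hl1 hz'.le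
    rw [(hasDerivAt_segmentIntegral hφ hz).deriv, extremalIntegrand_eq hl0 hl1 hz ha, extremalDenom]
    have e : z * (2 * (1 - (β : ℂ)) * ((0 * z + lam) / (1 + lam * (0 - 1) * z - 0 * z ^ 2)))
        = ((1 - β : ℝ) : ℂ) * (((2 * lam : ℝ) : ℂ) * (z / (1 - lam * z))) := by
      push_cast
      have : 1 + lam * (0 - 1) * z - 0 * z ^ 2 = 1 - lam * z := by ring
      rw [this]
      ring
    rw [e, Complex.re_ofReal_mul, Complex.re_ofReal_mul]
    have key : 0 ≤ (1 / (1 + lam) + (z / (1 - lam * z)).re) := by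
      have e2 : z / (1 - lam * z) = ((1 + z) / (1 - lam * z) - 1) / (1 + lam) := by
        have : (1 : ℂ) + lam ≠ 0 := by exact_mod_cast (by positivity : (1 + lam : ℝ) ≠ 0)
        generalize hS : 1 - lam * z = S at h0
        field_simp
        rw [← hS]
        ring
      have h3 : 0 ≤ ((1 + z) / (1 - lam * z)).re := by
        rw [← neg_nonpos, ← Complex.neg_re, ← neg_div]
        apply re_div_nonpos
        have := sq_add_sq_lt_one hz'
        simp
        have h4 : -1 ≤ z.re := by nlinarith [sq_nonneg z.im]
        nlinarith [mul_nonneg (sub_nonneg.2 hl1.le) (by linarith : 0 ≤ 1 + z.re),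
          mul_nonneg hl0 (sub_nonneg.2 this.le)]
      have e3 : ((1 : ℂ) + lam) = ((1 + lam : ℝ) : ℂ) := by push_cast; ring
      rw [e2, e3, Complex.div_ofReal_re, ← add_div, Complex.sub_re, Complex.one_re]
      apply div_nonneg <;> linarith
    have h5 := mul_nonneg (mul_nonneg (sub_nonneg.2 hβ1.le) (mul_nonneg zero_le_two hl0)) key
    have e4 : 2 * lam / (1 + lam) = 2 * lam * (1 / (1 + lam)) := by ring
    rw [e4]
    linarith
  -- `2ε` is the gap between this bound and `β - 1`; adding `c z²` changes `Re (z L')` by at most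
  -- `2‖c‖` and keeps `L(0)` and `L'(0)`.
  obtain ⟨ε, hε⟩ : ∃ ε, ε = (1 - β) * ((1 - lam) / (1 + lam)) / 2 := ⟨_, rfl⟩
  have hε0 : 0 < ε := by
    rw [hε]
    have : 0 < 1 - lam := by linarith
    have : 0 < 1 - β := by linarith
    positivity
  have hpert : ∀ c : ℂ, ‖c‖ < ε → L z₀ + c * z₀ ^ 2 ∈ region z₀ lam β := by
    intro c hc
    rw [region_eq hz₀]
    have hd : ∀ z ∈ unitDisk, deriv (fun z => L z + c * z ^ 2) z = deriv L z + c * (2 * z) := by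
      intro z hz
      refine (((hL.analytic.hasDerivAt_unitDisk hz).add
        ((hasDerivAt_pow 2 z).const_mul c)).congr_deriv ?_).deriv
      simp
    refine ⟨fun z => L z + c * z ^ 2, ⟨hL.analytic.add (by fun_prop), ?_, ?_, fun z hz => ?_⟩, rfl⟩
    · simp [hL.map_zero]
    · rw [hd 0 zero_mem_unitDisk, hL.deriv_zero]
      simp
    · have hz' := mem_unitDisk_iff.1 hz
      rw [hd z hz, mul_add, Complex.add_re]
      have h1 := hbound z hz
      have h2 : ‖z * (c * (2 * z))‖ ≤ 2 * ‖c‖ := by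
        have : z * (c * (2 * z)) = 2 * c * z ^ 2 := by ring
        rw [this, norm_mul, norm_mul, norm_pow]
        simpa using mul_le_of_le_one_right (by positivity) (pow_le_one₀ (norm_nonneg z) hz'.le)
      have h3 := (abs_le.1 (Complex.abs_re_le_norm (z * (c * (2 * z))))).1
      have h4 : (β - 1) * (2 * lam / (1 + lam)) = (β - 1) + 2 * ε := by
        rw [hε]
        field_simp
        ring
      linarith
  refine ⟨L z₀, mem_interior_iff_mem_nhds.2 ?_⟩
  have hcont : ContinuousAt (fun w => (w - L z₀) / z₀ ^ 2) (L z₀) := by fun_prop (disch := simpa)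
  have hball : ball (0 : ℂ) ε ∈ 𝓝 ((L z₀ - L z₀) / z₀ ^ 2) := by
    rw [sub_self, zero_div]
    exact ball_mem_nhds _ hε0
  filter_upwards [hcont hball] with w hw
  have := hpert ((w - L z₀) / z₀ ^ 2) (by simpa using hw)
  rwa [div_mul_cancel₀ _ (pow_ne_zero 2 hz₀0), add_sub_cancel] at this

/-! ### Schwarz representation and supporting half-planes. -/

theorem norm_lt_norm_one_add {v : ℂ} (hv : -1 < (2 * v).re) : ‖v‖ < ‖1 + v‖ := by
  apply norm_lt_norm_of_sq
  simp at hv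
  simp
  nlinarith

/-- The representation of `(log f')'` through a Schwarz function. -/
theorem IsLogClass.exists_deriv_eq (hβ1 : β < 1) (hl0 : 0 ≤ lam) (hl1 : lam < 1) {L : ℂ → ℂ}
    (hL : IsLogClass β lam L) {z : ℂ} (hz : z ∈ unitDisk) (hz0 : z ≠ 0) :
    ∃ g : ℂ, ‖g‖ ≤ 1 ∧
      deriv L z = 2 * (1 - (β : ℂ)) * ((g * z + lam) / extremalDenom g lam z) := by
  have hβ : (1 - (β : ℂ)) ≠ 0 := by
    have : (1 - β : ℝ) ≠ 0 := by linarith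
    exact_mod_cast this
  obtain ⟨u, hu⟩ : ∃ u : ℂ → ℂ, u = fun z => deriv L z / (2 * (1 - (β : ℂ))) := ⟨_, rfl⟩
  have hud : DifferentiableOn ℂ u unitDisk := by
    rw [hu]
    exact (hL.analytic.deriv isOpen_unitDisk).div_const _
  have hu0 : u 0 = lam := by
    rw [hu]
    simp only [hL.deriv_zero]
    field_simp
  have hv : ∀ w ∈ unitDisk, ‖w * u w‖ < ‖1 + w * u w‖ := by
    intro w hw
    apply norm_lt_norm_one_add
    have h1 := hL.re_gt w hw
    have e : w * deriv L w = ((1 - β : ℝ) : ℂ) * (2 * (w * u w)) := by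
      rw [hu]
      push_cast
      field_simp
    rw [e, Complex.re_ofReal_mul] at h1
    nlinarith
  have hne : ∀ w ∈ unitDisk, 1 + w * u w ≠ 0 := fun w hw =>
    norm_pos_iff.1 ((norm_nonneg _).trans_lt (hv w hw))
  -- `|z ω| < 1` on the disk, so Schwarz's lemma gives `|ω| ≤ 1`; moreover `ω(0) = λ`.
  obtain ⟨ω, hω⟩ : ∃ ω : ℂ → ℂ, ω = fun w => u w / (1 + w * u w) := ⟨_, rfl⟩
  have hωd : DifferentiableOn ℂ ω unitDisk := by
    rw [hω]
    exact hud.div ((differentiableOn_id.mul hud).const_add 1) hne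
  have hω0 : ω 0 = lam := by simp [hω, hu0]
  have hω1 : ∀ w ∈ unitDisk, ‖ω w‖ ≤ 1 := by
    intro w hw
    by_cases hw0 : w = 0
    · rw [hw0, hω0, Complex.norm_real, Real.norm_of_nonneg hl0]
      exact hl1.le
    have h := Complex.norm_le_norm_of_mapsTo_ball (f := fun w => w * ω w) (R := 1) (z := w)
      (differentiableOn_id.mul hωd) (fun v hv' => by
        rw [mem_closedBall_zero_iff, hω]
        simp only
        rw [← mul_div_assoc, norm_div]
        exact div_le_one_of_le₀ (hv v hv').le (norm_nonneg _)) (by simp) (mem_unitDisk_iff.1 hw)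
    rw [norm_mul] at h
    exact le_of_mul_le_mul_left (by simpa using h) (norm_pos_iff.2 hw0)
  -- Moving `λ` to `0` by a disk automorphism permits a second use of Schwarz's lemma.
  have hΩ := Complex.norm_le_norm_of_mapsTo_ball (f := fun w => (ω w - lam) / (1 - lam * ω w))
    (R := 1) (z := z) ((hωd.sub_const _).div ((hωd.const_mul _).const_sub 1) fun w hw =>
      one_sub_lam_mul_ne_zero hl0 hl1 (hω1 w hw)) (fun w hw => by
        rw [mem_closedBall_zero_iff, norm_div]
        exact div_le_one_of_le₀ (norm_sub_lam_le hl0 hl1 (hω1 w hw)) (norm_nonneg _))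
    (by simp [hω0]) (mem_unitDisk_iff.1 hz)
  obtain ⟨g, hg⟩ : ∃ g, g = (ω z - lam) / (1 - lam * ω z) / z := ⟨_, rfl⟩
  have hg1 : ‖g‖ ≤ 1 := by
    rw [hg, norm_div]
    exact div_le_one_of_le₀ hΩ (norm_nonneg _)
  refine ⟨g, hg1, ?_⟩
  have h1 : g * z * (1 - lam * ω z) = ω z - lam := by
    rw [hg, div_mul_cancel₀ _ hz0,
      div_mul_cancel₀ _ (one_sub_lam_mul_ne_zero hl0 hl1 (hω1 z hz))]
  have h2 : ω z * (1 + z * u z) = u z := by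
    rw [hω]
    exact div_mul_cancel₀ _ (hne z hz)
  have h3 : u z = (g * z + lam) / extremalDenom g lam z := by
    rw [eq_div_iff (extremalDenom_ne_zero hl0 hl1 hz hg1), extremalDenom]
    linear_combination (-(1 + lam * g * z)) * h2 - (1 + z * u z) * h1
  rw [← h3, hu]
  field_simp

theorem hasDerivAt_div_sq_extremalDenom {lam : ℝ} {a z : ℂ} (h0 : extremalDenom a lam z ≠ 0) :
    HasDerivAt (fun z => a / extremalDenom a lam z ^ 2)
      (-(2 * a * (lam * (a - 1) - 2 * a * z) / extremalDenom a lam z ^ 3)) z := by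
  have h1 : HasDerivAt (fun z => extremalDenom a lam z) (lam * (a - 1) - 2 * a * z) z := by
    have := (((hasDerivAt_id z).const_mul ((lam : ℂ) * (a - 1))).const_add 1).sub
      ((hasDerivAt_pow 2 z).const_mul a)
    refine this.congr_deriv ?_
    simp
    ring
  refine ((hasDerivAt_const z a).div (h1.pow 2) (pow_ne_zero 2 h0)).congr_deriv ?_
  field_simp
  simp
  ring

/-- `Re ((w - log F_a'(z₀)) / H) ≤ 0` is a supporting half-plane of the region of variability,
which touches it only at `log F_a'(z₀)`. -/
theorem exists_support {β lam : ℝ} (hβ1 : β < 1) (hl0 : 0 ≤ lam) (hl1 : lam < 1) {z₀ : ℂ}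
    (hz₀ : z₀ ∈ unitDisk) (hz₀0 : z₀ ≠ 0) {a : ℂ} (ha : ‖a‖ = 1) :
    ∃ H : ℂ, H ≠ 0 ∧ ∀ L, IsLogClass β lam L →
      ((L z₀ - segmentIntegral (extremalIntegrand a lam β) z₀) / H).re ≤ 0 ∧
      (L z₀ = segmentIntegral (extremalIntegrand a lam β) z₀ →
        EqOn L (segmentIntegral (extremalIntegrand a lam β)) unitDisk) := by
  have ha0 : a ≠ 0 := norm_pos_iff.1 (by rw [ha]; exact one_pos)
  have hP : ∀ z ∈ unitDisk, extremalDenom a lam z ≠ 0 := fun z hz =>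
    extremalDenom_ne_zero hl0 hl1 hz ha.le
  -- Up to a positive constant, `z h` is `a ∂/∂a` of the extremal integrand. Its primitive at `z₀`
  -- is thus `-i` times the tangent of the curve, a normal direction.
  obtain ⟨h, hdef⟩ : ∃ h : ℂ → ℂ, h = fun z => a / extremalDenom a lam z ^ 2 := ⟨_, rfl⟩
  have hh' : ∀ z ∈ unitDisk, HasDerivAt h
      (-(2 * a * (lam * (a - 1) - 2 * a * z) / extremalDenom a lam z ^ 3)) z := fun z hz => by
    rw [hdef]
    exact hasDerivAt_div_sq_extremalDenom (hP z hz)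
  have hh : DifferentiableOn ℂ h unitDisk := fun z hz =>
    (hh' z hz).differentiableAt.differentiableWithinAt
  have h0 : ∀ z ∈ unitDisk, h z ≠ 0 := fun z hz => by
    rw [hdef]
    exact div_ne_zero ha0 (pow_ne_zero 2 (hP z hz))
  have hK : ∀ z ∈ unitDisk, 0 < (2 + z * deriv h z / h z).re := by
    intro z hz
    have h1 := re_one_add_div_extremalDenom_pos hl0 hl1 hz ha
    have hPz := hP z hz
    have e : 2 + z * deriv h z / h z
        = ((2 : ℝ) : ℂ) * ((1 + a * z ^ 2) / extremalDenom a lam z) := by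
      rw [(hh' z hz).deriv, hdef]
      simp only
      have e2 : 1 + a * z ^ 2
          = extremalDenom a lam z - z * (lam * (a - 1) - 2 * a * z) := by
        rw [extremalDenom]; ring
      rw [e2]
      generalize extremalDenom a lam z = P at hPz
      field_simp
      push_cast
      ring
    rw [e, Complex.re_ofReal_mul]
    linarith
  obtain ⟨η, hη, hηh⟩ := exists_two_mul_add_mul_deriv_eq hh
  have hφ := differentiableOn_extremalIntegrand (β := β) hl0 hl1 ha.le
  have hM := isLogClass_extremal (β := β) hβ1 hl0 hl1 ha.le
  set M := segmentIntegral (extremalIntegrand a lam β) with hMdef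
  -- Only the nonvanishing of `η` is wanted here, so the compared function is zero.
  have hη0 : ∀ z ∈ unitDisk, η z ≠ 0 :=
    (comparison hh hη (κ := fun _ => 0) (d := fun _ => 0) (differentiableOn_const _) hηh
      (by simp) h0 hK (by simp)).1
  refine ⟨z₀ ^ 2 * η z₀, mul_ne_zero (pow_ne_zero 2 hz₀0) (hη0 z₀ hz₀), fun L hL => ?_⟩
  have hD' : DifferentiableOn ℂ (fun z => deriv L z - deriv M z) unitDisk :=
    (hL.analytic.deriv isOpen_unitDisk).sub (hM.analytic.deriv isOpen_unitDisk)
  -- `L'` and `M'` agree at `0`, so their difference is divisible by `z`.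
  obtain ⟨d, hddef⟩ : ∃ d, d = dslope (fun z => deriv L z - deriv M z) 0 := ⟨_, rfl⟩
  have hd : DifferentiableOn ℂ d unitDisk := by
    rw [hddef]
    exact (Complex.differentiableOn_dslope (isOpen_unitDisk.mem_nhds zero_mem_unitDisk)).2 hD'
  have hzd : ∀ z, z * d z = deriv L z - deriv M z := by
    intro z
    have := sub_smul_dslope (fun z => deriv L z - deriv M z) 0 z
    rw [← hddef] at this
    simpa [hL.deriv_zero, hM.deriv_zero] using this
  obtain ⟨κ, hκ, hκd⟩ := exists_two_mul_add_mul_deriv_eq hd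
  have hre : ∀ z ∈ unitDisk, (d z / h z).re ≤ 0 := by
    intro z hz
    refine forall_mem_of_punctured (g := fun z => d z / h z) (C := {w | w.re ≤ 0})
      (hd.div hh h0).continuousOn (isClosed_le Complex.continuous_re continuous_const) ?_ hz
    intro w hw hw0
    obtain ⟨g, hg, hLg⟩ := hL.exists_deriv_eq hβ1 hl0 hl1 hw hw0
    have hQ := extremalDenom_ne_zero hl0 hl1 hw hg
    have hPw := hP w hw
    have e : d w / h w = ((2 * (1 - β) * (1 - lam ^ 2) : ℝ) : ℂ) *
        ((g - a) * extremalDenom a lam w / (a * extremalDenom g lam w)) := by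
      have e1 := hzd w
      rw [hLg, hMdef, (hasDerivAt_segmentIntegral hφ hw).deriv,
        extremalIntegrand_eq hl0 hl1 hw ha.le] at e1
      have e2 : (g * w + lam) * extremalDenom a lam w - (a * w + lam) * extremalDenom g lam w
          = (g - a) * w * (1 - lam ^ 2) := by
        simp only [extremalDenom]
        ring
      have e3 : d w = 2 * (1 - (β : ℂ)) * ((g - a) * (1 - lam ^ 2) /
          (extremalDenom g lam w * extremalDenom a lam w)) := by
        refine mul_left_cancel₀ hw0 ?_
        rw [e1, ← mul_sub, div_sub_div _ _ hQ hPw, mul_comm (extremalDenom g lam w), e2]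
        ring
      rw [e3, hdef]
      simp only
      push_cast
      field_simp
    change (d w / h w).re ≤ 0
    rw [e, Complex.re_ofReal_mul]
    refine mul_nonpos_of_nonneg_of_nonpos ?_ (re_sub_mul_div_nonpos hl0 hl1 hw ha hg)
    have : 0 ≤ 1 - lam ^ 2 := by nlinarith
    have : 0 ≤ 1 - β := by linarith
    positivity
  obtain ⟨-, h1, h2⟩ := comparison hh hη hκ hηh hκd h0 hK hre
  have hdiff : ∀ z ∈ unitDisk, L z - M z = z ^ 2 * κ z := by
    refine isOpen_unitDisk.eqOn_of_deriv_eq isPreconnected_unitDisk (hL.analytic.sub hM.analytic)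
      ((differentiableOn_id.pow 2).mul hκ) ?_ zero_mem_unitDisk (by simp [hL.map_zero, hM.map_zero])
    intro z hz
    have e1 := ((hL.analytic.hasDerivAt_unitDisk hz).sub (hM.analytic.hasDerivAt_unitDisk hz)).deriv
    have e2 := ((hasDerivAt_pow 2 z).mul (hκ.hasDerivAt_unitDisk hz)).deriv
    change deriv (L - M) z = deriv ((fun z => z ^ 2) * κ) z
    rw [e1, e2, ← hzd, ← hκd z hz]
    simp
    ring
  constructor
  · rw [hdiff z₀ hz₀, mul_div_mul_left _ _ (pow_ne_zero 2 hz₀0)]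
    exact h1 z₀ hz₀
  · intro he z hz
    have hk : κ z₀ = 0 := by
      have := hdiff z₀ hz₀
      rw [he, sub_self] at this
      exact (mul_eq_zero.1 this.symm).resolve_left (pow_ne_zero 2 hz₀0)
    have := hdiff z hz
    rw [h2 z₀ hz₀ hk z hz, mul_zero] at this
    exact sub_eq_zero.1 this

/-! ### Jordan curves and planar convex sets. -/

/-- A closed curve in the real line is not injective. -/
theorem not_injOn_of_closed {g : ℝ → ℝ} {a b : ℝ} (hab : a < b) (hg : ContinuousOn g (Icc a b))
    (hcl : g a = g b) : ¬ InjOn g (Ioc a b) := by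
  intro hinj
  obtain ⟨c, hac, hcb⟩ := exists_between hab
  have hne : g c ≠ g b := fun h => hcb.ne (hinj ⟨hac, hcb.le⟩ ⟨hab, le_rfl⟩ h)
  have h1 : uIcc a c ⊆ Icc a b := by
    rw [uIcc_of_le hac.le]
    exact Icc_subset_Icc_right hcb.le
  have h2 : uIcc c b ⊆ Icc a b := by
    rw [uIcc_of_le hcb.le]
    exact Icc_subset_Icc_left hac.le
  -- This intermediate value is attained on both sides of `c`.
  have hv : (g c + g b) / 2 ∈ uIcc (g c) (g b) := by
    rcases le_total (g c) (g b) with h | h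
    · rw [uIcc_of_le h]
      constructor <;> linarith
    · rw [uIcc_of_ge h]
      constructor <;> linarith
  obtain ⟨y, hy, hgy⟩ := intermediate_value_uIcc (hg.mono h2) hv
  rw [uIcc_comm, ← hcl] at hv
  obtain ⟨x, hx, hgx⟩ := intermediate_value_uIcc (hg.mono h1) hv
  rw [uIcc_of_le hac.le] at hx
  rw [uIcc_of_le hcb.le] at hy
  have hxa : a ≠ x := by
    rintro rfl
    apply hne
    linarith
  have hxc : x ≠ c := by
    rintro rfl
    apply hne
    linarith
  have hxc' := lt_of_le_of_ne hx.2 hxc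
  have := hinj ⟨lt_of_le_of_ne hx.1 hxa, hx.2.trans hcb.le⟩ ⟨hac.trans_le hy.1, hy.2⟩
    (by rw [hgx, hgy, hcl])
  linarith [hy.1]

section Convex

variable {V : Set ℂ}

/-- A ray from an interior point of a convex set meets its frontier at most once. -/
theorem _root_.Convex.eq_of_mem_frontier_of_ray (hV : Convex ℝ V) {w x y : ℂ} (hw : w ∈ interior V)
    (hx : x ∈ frontier V) (hy : y ∈ frontier V) {r : ℝ} (hr : 0 < r) (h : y - w = r * (x - w)) :
    y = x := by
  have aux : ∀ {x y : ℂ} {r : ℝ}, x ∈ frontier V → y ∈ frontier V → 0 < r →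
      y - w = r * (x - w) → 1 ≤ r := by
    intro x y r hx hy hr h
    by_contra! hr1
    -- For `r < 1`, `y` lies strictly between an interior point and a point of the closure, hence in
    -- the interior.
    refine hy.2 (hV.openSegment_interior_closure_subset_interior hw hx.1
      ⟨1 - r, r, by linarith, hr, by ring, ?_⟩)
    rw [Complex.real_smul, Complex.real_smul]
    push_cast
    linear_combination -h
  have h1 := aux hx hy hr h
  have hr' : (r : ℂ) ≠ 0 := by exact_mod_cast hr.ne'
  have h2 := aux hy hx (inv_pos.2 hr) (by
    rw [h]
    push_cast
    field_simp)
  have : r = 1 := le_antisymm (by simpa using (le_inv_comm₀ one_pos hr).1 h2) h1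
  rw [this] at h
  push_cast at h
  linear_combination h

/-- A Jordan curve in the frontier of a planar convex set with interior is the whole frontier. -/
theorem _root_.Convex.frontier_eq_image_of_jordan (hV : Convex ℝ V) (hint : (interior V).Nonempty)
    {γ : ℝ → ℂ} (hγ : IsJordanParam γ)
    (hmem : ∀ θ ∈ Ioc (-Real.pi) Real.pi, γ θ ∈ frontier V) :
    frontier V = γ '' Ioc (-Real.pi) Real.pi := by
  refine Subset.antisymm (fun w hw => ?_) (image_subset_iff.2 hmem)
  by_contra hnot
  obtain ⟨w₀, hw₀⟩ := hint
  have hpi : -Real.pi < Real.pi := by linarith [Real.pi_pos]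
  have hmem' : ∀ θ ∈ Icc (-Real.pi) Real.pi, ∃ θ' ∈ Ioc (-Real.pi) Real.pi, γ θ = γ θ' := by
    intro θ hθ
    rcases hθ.1.eq_or_lt with h | h
    · exact ⟨Real.pi, ⟨hpi, le_rfl⟩, by rw [← h, hγ.closed]⟩
    · exact ⟨θ, ⟨h, hθ.2⟩, rfl⟩
  have hfr : ∀ θ ∈ Icc (-Real.pi) Real.pi, γ θ ∈ frontier V ∧ γ θ ≠ w := by
    intro θ hθ
    obtain ⟨θ', h', e⟩ := hmem' θ hθ
    exact ⟨e ▸ hmem θ' h', fun h => hnot ⟨θ', h', e ▸ h⟩⟩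
  have hne : ∀ v ∈ frontier V, v - w₀ ≠ 0 := by
    intro v hv h
    rw [sub_eq_zero.1 h] at hv
    exact hv.2 hw₀
  have hw0 : w₀ - w ≠ 0 := by
    rw [← neg_sub]
    exact neg_ne_zero.2 (hne w hw)
  -- Dividing by `w₀ - w` sends the ray from `w₀` through the omitted point `w` to the negative real
  -- axis, the cut of `arg`. The curve avoids this ray, and equal arguments mean a common ray, so
  -- `arg` would be a continuous injective closed real curve.
  have hψ0 : ∀ θ ∈ Icc (-Real.pi) Real.pi, (γ θ - w₀) / (w₀ - w) ≠ 0 := fun θ hθ =>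
    div_ne_zero (hne _ (hfr θ hθ).1) hw0
  have hslit : ∀ θ ∈ Icc (-Real.pi) Real.pi, (γ θ - w₀) / (w₀ - w) ∈ Complex.slitPlane := by
    intro θ hθ
    by_contra h
    rw [Complex.mem_slitPlane_iff_not_le_zero, not_not] at h
    obtain ⟨hle, him⟩ := Complex.le_def.1 h
    have e : (γ θ - w₀) / (w₀ - w) = ((((γ θ - w₀) / (w₀ - w)).re : ℝ) : ℂ) :=
      Complex.ext (by simp) (by simpa using him)
    obtain ⟨r, hr⟩ : ∃ r, r = ((γ θ - w₀) / (w₀ - w)).re := ⟨_, rfl⟩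
    rw [← hr] at e hle
    have hr0 : r ≠ 0 := fun h0 => hψ0 θ hθ (by rw [e, h0, Complex.ofReal_zero])
    refine (hfr θ hθ).2 (hV.eq_of_mem_frontier_of_ray hw₀ hw (hfr θ hθ).1 (r := -r) ?_ ?_)
    · exact neg_pos.2 (lt_of_le_of_ne (by simpa using hle) hr0)
    · rw [div_eq_iff hw0] at e
      rw [e]
      push_cast
      ring
  refine not_injOn_of_closed (g := fun θ => Complex.arg ((γ θ - w₀) / (w₀ - w))) hpi ?_ ?_ ?_
  · intro θ hθ
    have hc : ContinuousWithinAt (fun θ => (γ θ - w₀) / (w₀ - w)) (Icc (-Real.pi) Real.pi) θ :=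
      ((hγ.continuousOn θ hθ).sub continuousWithinAt_const).div_const _
    exact ContinuousAt.comp_continuousWithinAt (f := fun θ => (γ θ - w₀) / (w₀ - w))
      (Complex.continuousAt_arg (hslit θ hθ)) hc
  · simp only [hγ.closed]
  · intro θ hθ θ' hθ' h
    have hI := Ioc_subset_Icc_self hθ
    have hI' := Ioc_subset_Icc_self hθ'
    rw [Complex.arg_eq_arg_iff (hψ0 θ hI) (hψ0 θ' hI')] at h
    refine hγ.injOn hθ hθ' ?_
    refine (hV.eq_of_mem_frontier_of_ray hw₀ (hmem θ hθ) (hmem θ' hθ')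
      (r := ‖(γ θ' - w₀) / (w₀ - w)‖ / ‖(γ θ - w₀) / (w₀ - w)‖)
      (div_pos (norm_pos_iff.2 (hψ0 θ' hI')) (norm_pos_iff.2 (hψ0 θ hI))) ?_).symm
    rw [← mul_div_assoc, div_left_inj' hw0] at h
    rw [Complex.ofReal_div]
    exact h.symm

/-- If `v` were interior, `v + tH` would lie in `V` for small `t > 0` and violate the half-plane
condition. -/
theorem mem_frontier_of_support {v H : ℂ} (hv : v ∈ V) (hH : H ≠ 0)
    (h : ∀ w ∈ V, ((w - v) / H).re ≤ 0) : v ∈ frontier V := by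
  refine ⟨subset_closure hv, fun hint => ?_⟩
  have hc : ContinuousAt (fun t : ℝ => v + t * H) 0 := by fun_prop
  have hn : V ∈ 𝓝 (v + ((0 : ℝ) : ℂ) * H) := by
    simpa using mem_interior_iff_mem_nhds.1 hint
  have h1 : ∀ᶠ t : ℝ in 𝓝[>] 0, v + t * H ∈ V := nhdsWithin_le_nhds (hc hn)
  obtain ⟨t, ht, ht0⟩ := (h1.and self_mem_nhdsWithin).exists
  have := h _ ht
  rw [add_sub_cancel_left, mul_div_cancel_right₀ _ hH, Complex.ofReal_re] at this
  exact absurd ht0 (not_lt.2 this)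

end Convex

/-! ### The boundary curve and the theorem. -/

theorem continuous_segmentIntegral_extremal {β lam : ℝ} (hl0 : 0 ≤ lam) (hl1 : lam < 1) {z : ℂ}
    (hz : z ∈ unitDisk) : Continuous fun θ : ℝ =>
      segmentIntegral (extremalIntegrand (Complex.exp (θ * Complex.I)) lam β) z := by
  -- `τ` clamps to `[0, 1]`, which makes the integrand jointly continuous for all real `t` without
  -- changing the integral.
  obtain ⟨τ, hτc, hτ, hmem⟩ : ∃ τ : ℝ → ℝ, Continuous τ ∧ (∀ t ∈ Icc (0 : ℝ) 1, τ t = t) ∧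
      ∀ t, (τ t : ℂ) * z ∈ unitDisk := by
    refine ⟨fun t => max 0 (min t 1), by fun_prop,
      fun t ht => by simp [min_eq_left ht.2, max_eq_right ht.1], fun t => ?_⟩
    refine mem_unitDisk_of_norm_le hz ?_
    rw [norm_mul, Complex.norm_real, Real.norm_of_nonneg (le_max_left _ _)]
    exact mul_le_of_le_one_left (norm_nonneg _) (max_le zero_le_one (min_le_right _ _))
  have hnorm : ∀ θ : ℝ, ‖Complex.exp (θ * Complex.I)‖ ≤ 1 := fun θ =>
    (Complex.norm_exp_ofReal_mul_I θ).le
  have e : ∀ θ : ℝ, segmentIntegral (extremalIntegrand (Complex.exp (θ * Complex.I)) lam β) z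
      = ∫ t in (0 : ℝ)..1, 2 * (1 - (β : ℂ)) *
        ((Complex.exp (θ * Complex.I) * ((τ t : ℂ) * z) + lam) /
          extremalDenom (Complex.exp (θ * Complex.I)) lam ((τ t : ℂ) * z)) * z := by
    intro θ
    refine intervalIntegral.integral_congr fun t ht => ?_
    rw [uIcc_of_le zero_le_one] at ht
    have := hmem t
    simp only [hτ t ht] at this ⊢
    rw [extremalIntegrand_eq hl0 hl1 this (hnorm θ)]
  simp only [e]
  refine intervalIntegral.continuous_parametric_intervalIntegral_of_continuous' ?_ _ _
  have hden : Continuous fun p : ℝ × ℝ =>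
      extremalDenom (Complex.exp (p.1 * Complex.I)) lam ((τ p.2 : ℂ) * z) := by
    unfold extremalDenom
    fun_prop
  have hnum : Continuous fun p : ℝ × ℝ =>
      Complex.exp (p.1 * Complex.I) * ((τ p.2 : ℂ) * z) + lam := by fun_prop
  exact (continuous_const.mul (hnum.div hden fun p =>
    extremalDenom_ne_zero hl0 hl1 (hmem p.2) (hnorm p.1))).mul continuous_const

theorem extremal_eq (a : ℂ) (lam β : ℝ) : extremal a lam β = segmentIntegral fun z =>
    Complex.exp (segmentIntegral (extremalIntegrand a lam β) z) := rfl

theorem eq_of_extremalIntegrand_eq {β lam : ℝ} (hβ1 : β < 1) (hl0 : 0 ≤ lam) (hl1 : lam < 1)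
    {a b z : ℂ} (ha : ‖a‖ ≤ 1) (hb : ‖b‖ ≤ 1) (hz : z ∈ unitDisk) (hz0 : z ≠ 0)
    (h : extremalIntegrand a lam β z = extremalIntegrand b lam β z) : a = b := by
  have hβ : 2 * (1 - (β : ℂ)) ≠ 0 := by
    have : (2 * (1 - β) : ℝ) ≠ 0 := by linarith
    exact_mod_cast this
  have hl : 1 - (lam : ℂ) ^ 2 ≠ 0 := by
    have : (1 - lam ^ 2 : ℝ) ≠ 0 := by nlinarith
    exact_mod_cast this
  rw [extremalIntegrand_eq hl0 hl1 hz ha, extremalIntegrand_eq hl0 hl1 hz hb,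
    mul_right_inj' hβ, div_eq_div_iff (extremalDenom_ne_zero hl0 hl1 hz ha)
      (extremalDenom_ne_zero hl0 hl1 hz hb)] at h
  have h1 : (a - b) * (z * (1 - (lam : ℂ) ^ 2)) = 0 := by
    simp only [extremalDenom] at h
    linear_combination h
  exact sub_eq_zero.1 ((mul_eq_zero.1 h1).resolve_right (mul_ne_zero hz0 hl))

end RegionOfVariability

theorem theorem3p5 (β lam : ℝ) (hβ0 : 0 < β) (hβ1 : β < 1) (hlam0 : 0 ≤ lam) (hlam1 : lam < 1)
    (z₀ : ℂ) (hz₀ : z₀ ∈ unitDisk) (hz₀0 : z₀ ≠ 0) :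
    -- each `F_{e^{iθ},λ}` lies in `𝓕(λ)`, with the stated formula for `log F'`
    (∀ θ ∈ Set.Ioc (-Real.pi) Real.pi,
      extremal (Complex.exp (θ * Complex.I)) lam β ∈ classF β lam ∧
      logBranch (deriv (extremal (Complex.exp (θ * Complex.I)) lam β)) z₀ =
        segmentIntegral (extremalIntegrand (Complex.exp (θ * Complex.I)) lam β) z₀) ∧
    -- `∂V` is the Jordan curve `θ ↦ log F'_{e^{iθ},λ}(z₀)`
    IsJordanParam (fun θ : ℝ =>
      logBranch (deriv (extremal (Complex.exp (θ * Complex.I)) lam β)) z₀) ∧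
    frontier (region z₀ lam β) =
      (fun θ : ℝ => logBranch (deriv (extremal (Complex.exp (θ * Complex.I)) lam β)) z₀) ''
        Set.Ioc (-Real.pi) Real.pi ∧
    -- uniqueness of the extremal functions
    (∀ f ∈ classF β lam, ∀ θ ∈ Set.Ioc (-Real.pi) Real.pi,
      logBranch (deriv f) z₀ =
        logBranch (deriv (extremal (Complex.exp (θ * Complex.I)) lam β)) z₀ →
      Set.EqOn f (extremal (Complex.exp (θ * Complex.I)) lam β) unitDisk) := by
  have hn : ∀ θ : ℝ, ‖Complex.exp (θ * Complex.I)‖ = 1 := Complex.norm_exp_ofReal_mul_I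
  have hM : ∀ θ : ℝ, IsLogClass β lam
      (segmentIntegral (extremalIntegrand (Complex.exp (θ * Complex.I)) lam β)) := fun θ =>
    isLogClass_extremal hβ1 hlam0 hlam1 (hn θ).le
  have hφ : ∀ θ : ℝ, DifferentiableOn ℂ
      (extremalIntegrand (Complex.exp (θ * Complex.I)) lam β) unitDisk := fun θ =>
    differentiableOn_extremalIntegrand hlam0 hlam1 (hn θ).le
  have hlog : ∀ θ : ℝ, logBranch (deriv (extremal (Complex.exp (θ * Complex.I)) lam β)) z₀ =
      segmentIntegral (extremalIntegrand (Complex.exp (θ * Complex.I)) lam β) z₀ := fun θ =>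
    logBranch_deriv_segmentIntegral_exp (hM θ).analytic (hM θ).map_zero hz₀
  have hJ : IsJordanParam (fun θ : ℝ =>
      segmentIntegral (extremalIntegrand (Complex.exp (θ * Complex.I)) lam β) z₀) := by
    refine ⟨(continuous_segmentIntegral_extremal hlam0 hlam1 hz₀).continuousOn, ?_, ?_⟩
    · have : Complex.exp (((-Real.pi : ℝ) : ℂ) * Complex.I)
          = Complex.exp ((Real.pi : ℂ) * Complex.I) := by
        rw [Complex.ofReal_neg, neg_mul, Complex.exp_neg, Complex.exp_pi_mul_I]
        norm_num
      simp only [this]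
    · intro θ hθ θ' hθ' h
      -- Equality at `z₀` spreads to the disk by rigidity; the derivatives at `z₀` then determine
      -- `e^{iθ}`.
      obtain ⟨H, -, hH⟩ := exists_support hβ1 hlam0 hlam1 hz₀ hz₀0 (hn θ')
      have hE := (hH _ (hM θ)).2 h
      have hd := (Filter.eventuallyEq_of_mem (isOpen_unitDisk.mem_nhds hz₀) hE).deriv_eq
      rw [(hasDerivAt_segmentIntegral (hφ θ) hz₀).deriv,
        (hasDerivAt_segmentIntegral (hφ θ') hz₀).deriv] at hd
      have he := eq_of_extremalIntegrand_eq hβ1 hlam0 hlam1 (hn θ).le (hn θ').le hz₀ hz₀0 hd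
      have := Complex.exp_inj_of_neg_pi_lt_of_le_pi (by simpa using hθ.1) (by simpa using hθ.2)
        (by simpa using hθ'.1) (by simpa using hθ'.2) he
      exact_mod_cast mul_right_cancel₀ Complex.I_ne_zero this
  refine ⟨fun θ _ => ⟨(hM θ).segmentIntegral_exp_mem, hlog θ⟩, ?_, ?_, ?_⟩
  · simpa only [hlog] using hJ
  · simp only [hlog]
    refine (convex_region hz₀).frontier_eq_image_of_jordan
      (interior_region_nonempty hβ1 hlam0 hlam1 hz₀ hz₀0) hJ fun θ _ => ?_
    obtain ⟨H, hH0, hH⟩ := exists_support hβ1 hlam0 hlam1 hz₀ hz₀0 (hn θ)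
    refine mem_frontier_of_support ?_ hH0 ?_
    · rw [region_eq hz₀]
      exact ⟨_, hM θ, rfl⟩
    · rw [region_eq hz₀]
      rintro _ ⟨L, hL, rfl⟩
      exact (hH L hL).1
  · intro f hf θ _ h
    obtain ⟨H, -, hH⟩ := exists_support hβ1 hlam0 hlam1 hz₀ hz₀0 (hn θ)
    have hE := (hH _ (isLogClass_logBranch hf)).2 (h.trans (hlog θ))
    refine isOpen_unitDisk.eqOn_of_deriv_eq isPreconnected_unitDisk hf.1.analytic
      (differentiableOn_segmentIntegral (hM θ).analytic.cexp) ?_ zero_mem_unitDisk ?_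
    · intro z hz
      rw [extremal_eq, (hasDerivAt_segmentIntegral (hM θ).analytic.cexp hz).deriv, ← hE hz]
      exact (hf.1.isLogBranch.exp_eq z hz).symm
    · rw [hf.1.map_zero, extremal_eq, segmentIntegral_zero]
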